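/- **Setting.** Let $W$ be a countable set of worlds with an accessibility relation $R\subseteq W\times W$ (for instance a preorder, i.e. an $\mathsf{S4}$ frame), let $w_0\in W$, and let $L$ be a finite set of propositional atoms. Let $G$ be the group of automorphisms of $(W,R)$ that fix $w_0$, and let $\mathcal O$ be the set of $G$-orbits in the accessible cluster $\{w: R(w_0,w)\}$. Let $\Omega=(\{0,1\}^L)^W$ carry the product $\sigma$-field and the action $(\pi\cdot V)(w)=V(\pi^{-1}(w))$, and let $\mathcal M$ be the space of probability measures on $\{0,1\}^L$. A probability measure $P$ on $\Omega$ is *modally exchangeable* if $P(\pi^{-1}(A))=P(A)$ for all $\pi\in G$ and all measurable $A\subseteq\Omega$. Let $\mathcal F^G_P$ be the $\sigma$-field of measurable $A\subseteq\Omega$ with $P(A\,\triangle\,\pi^{-1}(A))=0$ for all $\pi\in G$. A family of *directing laws* of $P$ is a family of random measures $\Lambda_O:\Omega\to\mathcal M$ $(O\in\mathcal O)$ such that, for each $O$: $\Lambda_O$ is $\mathcal F^G_P$-measurable; $\Lambda_O(\pi\cdot V)=\Lambda_O(V)$ $P$-a.s. for every $\pi\in G$; and both conditionally on $\Lambda_O$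 and conditionally on $\mathcal F^G_P$ the valuations $\{V(w)\}_{w\in O}$ are i.i.d. with law $\Lambda_O$. **Proposition (Hyperintensional discrimination).** Let $O_1\ne O_2$ be distinct orbits in $\mathcal O$. 1. *(Arbitrary priors.)* Let $\rho$ be any probability measure on $\mathcal M\times\mathcal M$ such that, for $i=1,2$, if $O_i$ is finite, then the $i$-th marginal of $\rho$ is concentrated on point masses (no condition is imposed for an infinite orbit). Then there is a modally exchangeable probability measure $P$ on $\Omega$ with a family of directing laws $(\Lambda_O)_{O\in\mathcal O}$ such that $(\Lambda_{O_1},\Lambda_{O_2})$ has law $\rho$ under $P$. In particular, if $O_1$ and $O_2$ are infinite, the marginal priors of $\Lambda_{O_1}$ and $\Lambda_{O_2}$ can be any two laws on $\mathcal M$, equal or distinct, with any joint law. 2. *(Latent version, for orbits of every size.)* Let $\rho$ be any probability measure on $\mathcal M\times\mathcal M$. Then there is a joint law $Q$ of a random valuation $V\in\Omega$ and of random laws $(\Lambda_O)_{O\in\mathcal O}\in\mathcal M^{\mathcal O}$ such that the law of $V$ is modally exchangeable, $(\pi\cdot V,(\Lambda_O)_O)$ has law $Q$ for every $\pi\in G$,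 for each $O$ the valuations $\{V(w)\}_{w\in O}$ are i.i.d. with law $\Lambda_O$ both conditionally on $\Lambda_O$ and conditionally on the whole family $(\Lambda_{O'})_{O'\in\mathcal O}$, and $(\Lambda_{O_1},\Lambda_{O_2})$ has law $\rho$. 3. *(The directing laws can differ.)* If $L\neq\varnothing$, there is a modally exchangeable $P$ with a family of directing laws such that $\Lambda_{O_1}\ne\Lambda_{O_2}$ $P$-almost surely. 4. *(Different credences.)* Let $B_1,B_2$ be nonempty proper subsets of $\{0,1\}^L$ (possibly $B_1=B_2$, that is, the same local proposition) and let $p_1,p_2\in[0,1]$. Then there is a modally exchangeable $P$ with a family of directing laws such that, for $i=1,2$, $P(V(w)\in B_i)=\mathbb E_P[\Lambda_{O_i}(B_i)]=p_i$ for every $w\in O_i$. -/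

import Mathlib

open MeasureTheory

noncomputable section

namespace ModalExch

/-- Valuations on the set `W` of worlds, for the set `L` of propositional atoms: elements of
`({0,1}^L)^W`, with the product `σ`-field. -/
abbrev Valuation (W L : Type*) := W → L → Bool

/-- The probability laws on the local state space `{0,1}^L`. -/
abbrev LocalLaw (L : Type*) := ProbabilityMeasure (L → Bool)

/-- The accessible cluster of `w₀`. -/
def cluster {W : Type*} (R : W → W → Prop) (w₀ : W) : Set W := {w | R w₀ w}

/-- The stabilizer of `w₀` in the group of automorphisms of the frame `(W, R)`. -/
abbrev Stab {W : Type*} (R : W → W → Prop) (w₀ : W) : Subgroup (R ≃r R) :=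
  MulAction.stabilizer (R ≃r R) w₀

/-- The orbits of the stabilizer of `w₀` in the accessible cluster of `w₀`. -/
def Orbits {W : Type*} (R : W → W → Prop) (w₀ : W) : Set (Set W) :=
  {O | ∃ v ∈ cluster R w₀, O = {v' | ∃ π ∈ Stab R w₀, π v = v'}}

/-- The action of automorphisms on valuations: `(π · V)(w) = V(π⁻¹ w)`. -/
def act {W L : Type*} {R : W → W → Prop} (π : R ≃r R) (V : Valuation W L) : Valuation W L :=
  fun w => V (π⁻¹ w)

/-- Invariance of a measure on valuations under the stabilizer of `w₀`. -/
def ModallyExchangeable {W L : Type*} (R : W → W → Prop) (w₀ : W)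
    (P : Measure (Valuation W L)) : Prop :=
  ∀ π ∈ Stab R w₀, ∀ A : Set (Valuation W L), MeasurableSet A → P (act π ⁻¹' A) = P A

/-- The `G`-invariant `σ`-field of `P`, for `G` the stabilizer of `w₀`: the measurable events that
every element of `G` preserves up to a `P`-null set. -/
abbrev invariantField {W L : Type*} (R : W → W → Prop) (w₀ : W) (P : Measure (Valuation W L)) :
    MeasurableSpace (Valuation W L) where
  MeasurableSet' A := MeasurableSet A ∧ ∀ π ∈ Stab R w₀, (act π ⁻¹' A : Set _) =ᵐ[P] A
  measurableSet_empty := ⟨MeasurableSet.empty, fun _ _ => by simp⟩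
  measurableSet_compl A hA := ⟨hA.1.compl, fun π hπ => by
    rw [Set.preimage_compl]; exact (hA.2 π hπ).compl⟩
  measurableSet_iUnion A hA := ⟨MeasurableSet.iUnion fun i => (hA i).1, fun π hπ => by
    rw [Set.preimage_iUnion]; exact Filter.EventuallyEq.countable_iUnion fun i => (hA i).2 π hπ⟩

/-- On the probability space `(X, Q)`, conditionally on the sub-`σ`-field `m`, the local valuations
`(V w)`, `w ∈ O`, are i.i.d. with (random) law `Λ`: for all finitely many distinct worlds `w` in `O`
and sets `B w` of local states, `Q(V w ∈ B w for all w | m) = ∏ Λ (B w)` almost surely. -/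
def CondIID {X W L : Type*} [MeasurableSpace X] (Q : Measure X) (m : MeasurableSpace X)
    (V : X → Valuation W L) (O : Set W) (Λ : X → LocalLaw L) : Prop :=
  ∀ F : Finset W, (F : Set W) ⊆ O → ∀ B : W → Set (L → Bool),
    Q[fun x => ∏ w ∈ F, (B w).indicator (fun _ => (1 : ℝ)) (V x w) | m]
      =ᵐ[Q] fun x => ∏ w ∈ F, (Λ x : Measure (L → Bool)).real (B w)

/-- `Λ` is a family of (rigid) directing laws of `P`, indexed by the orbits: random laws on
`{0,1}^L`, defined on the valuation space, each of them measurable for the invariant `σ`-field and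
almost surely unchanged by every element of the stabilizer, such that the valuations within an
orbit `O` are i.i.d. with law `Λ O`, both conditionally on `Λ O` and conditionally on the invariant
`σ`-field. -/
structure IsDirectingFamily {W L : Type*} (R : W → W → Prop) (w₀ : W)
    (P : Measure (Valuation W L)) (Λ : Orbits R w₀ → Valuation W L → LocalLaw L) : Prop where
  measurable : ∀ O, Measurable[invariantField R w₀ P] (Λ O)
  rigid : ∀ O, ∀ π ∈ Stab R w₀, (fun V => Λ O (act π V)) =ᵐ[P] Λ O
  iid_given_law : ∀ O : Orbits R w₀,
    CondIID P (MeasurableSpace.comap (Λ O) inferInstance) id (O : Set W) (Λ O)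
  iid_given_invariant : ∀ O : Orbits R w₀,
    CondIID P (invariantField R w₀ P) id (O : Set W) (Λ O)

/-- A joint law `Q` of a valuation and of a family `(Λ_O)` of latent laws on `{0,1}^L`, indexed by
the orbits, is a latent orbit-wise representation if it is invariant under the action of the
stabilizer on the valuation (the latent laws staying fixed), and if the valuations within an
orbit `O` are i.i.d. with law `Λ_O`, both conditionally on `Λ_O` and conditionally on the whole
family of latent laws. -/
structure IsLatentRepresentation {W L : Type*} (R : W → W → Prop) (w₀ : W)
    (Q : Measure (Valuation W L × (Orbits R w₀ → LocalLaw L))) : Prop where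
  invariant : ∀ π ∈ Stab R w₀, Q.map (fun x => (act π x.1, x.2)) = Q
  iid_given_law : ∀ O : Orbits R w₀,
    CondIID Q (MeasurableSpace.comap (fun x => x.2 O) inferInstance) Prod.fst (O : Set W)
      (fun x => x.2 O)
  iid_given_all : ∀ O : Orbits R w₀,
    CondIID Q (MeasurableSpace.comap Prod.snd inferInstance) Prod.fst (O : Set W)
      (fun x => x.2 O)

/-- The law `l` is a point mass. -/
def IsPointMass {L : Type*} (l : LocalLaw L) : Prop :=
  ∃ s : L → Bool, (l : Measure (L → Bool)) = Measure.dirac s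

end ModalExch

end

noncomputable section

namespace ModalExch

open Filter ProbabilityTheory Set
open scoped ENNReal Topology Pointwise symmDiff

/-! Everything comes from one mixture, `jointLaw ν`: draw laws `θ O`, one per orbit, from a prior
`ν`, then let the valuation be independent over worlds with law `θ O` on `O`. Automorphisms fixing
`w₀` permute worlds within orbits, so they preserve this law while `θ` stays fixed. This already is
the latent version, with `ν` the image of `ρ` under `extendLaws`.

For directing laws on the valuation space, `θ O` must be recovered from the valuation: by the strong
law of large numbers on an infinite orbit, and from a single world on a finite orbit, where `θ O` is
almost surely a point mass (`ae_directingLaw_eq`). Rigidity and invariance follow, since the action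
leaves `θ` alone.

What remains is conditioning on the whole invariant field. On a finite orbit the valuations are
almost surely functions of the directing law. On an infinite orbit, let `A` be invariant and let `E`
constrain finitely many worlds of `O`. Approximate `A` by a cylinder over a finite `D`; Neumann's
lemma gives a `π` moving the worlds of `E` off `D`. Then `P (A ∩ E)` equals the measure of `A`
intersected with the translate of `E`, and given `θ` that translate is independent of the cylinder.

Distinct laws and prescribed credences come from priors carried by point masses, which are
admissible for orbits of every size. -/

/-! ### Separating finite sets by a group action with infinite orbits -/

/-- B. H. Neumann's separation lemma. -/
theorem exists_smul_notMem_of_infinite_orbit {G α : Type*} [Group G] [MulAction G α]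
    (F D : Finset α) (hF : ∀ w ∈ F, (MulAction.orbit G w).Infinite) :
    ∃ g : G, ∀ w ∈ F, g • w ∉ D := by
  classical
  by_contra! h
  -- For `p = (w, d)`, the elements sending `w` to `d` form a left coset of the stabilizer of `w`,
  -- with representative `c p`. If no `g` separates `F` from `D`, finitely many such cosets cover
  -- `G`.
  let s : Finset (α × α) := (F ×ˢ D).filter fun p => ∃ g : G, g • p.1 = p.2
  let c : α × α → G := fun p => if hp : ∃ g : G, g • p.1 = p.2 then hp.choose else 1
  have hcover : ⋃ p ∈ s, c p • (MulAction.stabilizer G p.1 : Set G) = Set.univ := by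
    refine Set.eq_univ_of_forall fun g => ?_
    obtain ⟨w, hw, hd⟩ := h g
    have hp : ∃ g' : G, g' • (w, g • w).1 = (w, g • w).2 := ⟨g, rfl⟩
    refine Set.mem_biUnion (x := (w, g • w)) ?_ ?_
    · exact Finset.mem_coe.2 (Finset.mem_filter.2 ⟨Finset.mem_product.2 ⟨hw, hd⟩, hp⟩)
    · rw [mem_leftCoset_iff, SetLike.mem_coe, MulAction.mem_stabilizer_iff]
      have hc : c (w, g • w) • w = g • w := by
        simp only [c, dif_pos hp]
        exact hp.choose_spec
      rw [mul_smul, inv_smul_eq_iff]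
      exact hc.symm
  -- In a finite cover by cosets some subgroup has finite index; a stabilizer of finite index means
  -- a finite orbit.
  obtain ⟨p, hp, hfin⟩ := Subgroup.exists_finiteIndex_of_leftCoset_cover hcover
  refine hF p.1 (Finset.mem_product.1 (Finset.mem_filter.1 hp).1).1 ?_
  have : Finite (G ⧸ MulAction.stabilizer G p.1) := Subgroup.finite_quotient_of_finiteIndex
  exact Set.finite_coe_iff.1
    (Finite.of_equiv _ (MulAction.orbitEquivQuotientStabilizer G p.1).symm)

/-! ### Laws of sequences of observations -/

section LimitLaw

variable {S : Type*} [MeasurableSpace S]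

/-- The upper asymptotic frequency of the value `s` in the sequence `x`. -/
def limitFreq (x : ℕ → S) (s : S) : ℝ≥0∞ :=
  -- A limsup exists for every sequence, so measurability needs no discussion of convergence.
  limsup (fun n : ℕ => ENNReal.ofReal
    ((∑ i ∈ Finset.range n, ({s} : Set S).indicator (fun _ => (1 : ℝ)) (x i)) / n)) atTop

/-- The measure given by the upper asymptotic frequencies of a sequence. -/
def limitMeasure (x : ℕ → S) : Measure S :=
  Measure.sum fun s => limitFreq x s • Measure.dirac s

open Classical in
/-- The asymptotic empirical law of a sequence, with a default value for the sequences which do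
not have one. -/
def limitLaw (x : ℕ → S) : ProbabilityMeasure S :=
  if h : IsProbabilityMeasure (limitMeasure x) then (⟨limitMeasure x, h⟩ : ProbabilityMeasure S)
  else (⟨Measure.dirac (x 0), inferInstance⟩ : ProbabilityMeasure S)

theorem measurable_limitFreq [MeasurableSingletonClass S] (s : S) : Measurable fun x : ℕ → S => limitFreq x s := by
  refine Measurable.limsup fun n => ENNReal.measurable_ofReal.comp ?_
  refine Measurable.div_const (Finset.measurable_sum _ fun i _ => ?_) _
  exact (measurable_const.indicator (measurableSet_singleton s)).comp (measurable_pi_apply i)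

variable [Countable S] [MeasurableSingletonClass S]

theorem measurable_limitMeasure : Measurable (limitMeasure : (ℕ → S) → Measure S) := by
  refine Measure.measurable_of_measurable_coe _ fun A hA => ?_
  simp only [limitMeasure, Measure.sum_apply _ hA, Measure.smul_apply, smul_eq_mul]
  exact Measurable.tsum fun s => (measurable_limitFreq s).mul_const _

theorem measurable_limitLaw : Measurable (limitLaw : (ℕ → S) → ProbabilityMeasure S) := by
  classical
  have hP : MeasurableSet {x : ℕ → S | IsProbabilityMeasure (limitMeasure x)} :=
    measurable_limitMeasure ProbabilityMeasure.measurableSet_isProbabilityMeasure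
  have h : Measurable fun x : ℕ → S => ((limitLaw x : ProbabilityMeasure S) : Measure S) := by
    have heq : (fun x : ℕ → S => ((limitLaw x : ProbabilityMeasure S) : Measure S))
        = fun x => if IsProbabilityMeasure (limitMeasure x) then limitMeasure x
            else Measure.dirac (x 0) := by
      funext x
      by_cases hx : IsProbabilityMeasure (limitMeasure x)
      · have h' : limitLaw x = (⟨limitMeasure x, hx⟩ : ProbabilityMeasure S) := dif_pos hx
        rw [if_pos hx, h']; rfl
      · have h' : limitLaw x = (⟨Measure.dirac (x 0), inferInstance⟩ : ProbabilityMeasure S) :=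
          dif_neg hx
        rw [if_neg hx, h']; rfl
    rw [heq]
    exact Measurable.ite hP measurable_limitMeasure
      (Measure.measurable_dirac.comp (measurable_pi_apply 0))
  exact measurable_comap_iff.2 h

theorem limitLaw_eq_of_limitFreq {x : ℕ → S} {l : ProbabilityMeasure S}
    (h : ∀ s, limitFreq x s = (l : Measure S) {s}) : limitLaw x = l := by
  have hl : limitMeasure x = l := by
    simp only [limitMeasure, h]
    exact Measure.sum_smul_dirac _
  have : IsProbabilityMeasure (limitMeasure x) := hl ▸ inferInstance
  have h' : limitLaw x = (⟨limitMeasure x, this⟩ : ProbabilityMeasure S) := dif_pos this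
  exact h'.trans (Subtype.ext hl)

/-- The strong law, applied to the indicator of each singleton. Since `S` is countable, the
exceptional null sets combine into one, and the masses of singletons determine the law. -/
theorem ae_limitLaw_eq (l : ProbabilityMeasure S) :
    ∀ᵐ x ∂Measure.infinitePi (fun _ : ℕ => (l : Measure S)), limitLaw x = l := by
  have key : ∀ s : S, ∀ᵐ x ∂Measure.infinitePi (fun _ : ℕ => (l : Measure S)),
      limitFreq x s = (l : Measure S) {s} := by
    intro s
    let f : S → ℝ := ({s} : Set S).indicator fun _ => 1
    have hf : Measurable f := measurable_const.indicator (measurableSet_singleton s)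
    have hmap : ∀ i : ℕ, (Measure.infinitePi (fun _ : ℕ => (l : Measure S))).map (fun x => x i) = l :=
      fun i => Measure.infinitePi_map_eval _ i
    have hint : Integrable f (l : Measure S) :=
      (integrable_const (1 : ℝ)).indicator (measurableSet_singleton s)
    have hslln := strong_law_ae_real (μ := Measure.infinitePi (fun _ : ℕ => (l : Measure S)))
      (fun i x => f (x i)) ?_ ?_ ?_
    · have hval : ∫ x, f (x 0) ∂Measure.infinitePi (fun _ : ℕ => (l : Measure S))
          = (l : Measure S).real {s} := by
        rw [← integral_map (φ := fun x : ℕ → S => x 0) (f := f)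
          (measurable_pi_apply 0).aemeasurable (hf.aestronglyMeasurable), hmap]
        exact integral_indicator_one (measurableSet_singleton s)
      rw [hval] at hslln
      filter_upwards [hslln] with x hx
      have := (ENNReal.continuous_ofReal.tendsto _).comp hx
      rw [ofReal_measureReal] at this
      exact this.limsup_eq
    · exact (integrable_map_measure (g := f) (f := fun x : ℕ → S => x 0)
        hf.aestronglyMeasurable (measurable_pi_apply 0).aemeasurable).1 (by rw [hmap]; exact hint)
    · intro i j hij
      exact (iIndepFun_infinitePi (P := fun _ : ℕ => (l : Measure S)) (X := fun _ => f)
        fun _ => hf).indepFun hij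
    · intro i
      refine IdentDistrib.comp (u := f) ⟨(measurable_pi_apply i).aemeasurable,
        (measurable_pi_apply 0).aemeasurable, ?_⟩ hf
      rw [hmap, hmap]
  filter_upwards [ae_all_iff.2 key] with x hx using limitLaw_eq_of_limitFreq hx

end LimitLaw

/-! ### Events that are asymptotically independent of the cylinders -/

/-- If the measure of `A ∩ E` can be computed, up to replacing `E` by another set, from sets `C`
which approximate `A`, then it is the integral over `A` of the limiting density. -/
theorem measure_eq_setLIntegral_of_approx {X : Type*} [MeasurableSpace X] {P : Measure X}
    [IsFiniteMeasure P] {f : X → ℝ≥0∞} (hf : ∀ x, f x ≤ 1) {A : Set X} {a : ℝ≥0∞}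
    (h : ∀ ε : ℝ≥0∞, 0 < ε → ∃ C E : Set X, P (C ∆ A) < ε ∧ a = P (A ∩ E) ∧
      P (C ∩ E) = ∫⁻ x in C, f x ∂P) :
    a = ∫⁻ x in A, f x ∂P := by
  -- As the density is at most 1, changing the domain of integration costs at most the measure of
  -- the difference.
  have hle : ∀ U V : Set X, ∫⁻ x in U, f x ∂P ≤ ∫⁻ x in V, f x ∂P + P (U \ V) := by
    intro U V
    calc ∫⁻ x in U, f x ∂P ≤ ∫⁻ x in V ∪ U \ V, f x ∂P :=
          lintegral_mono_set (by rw [union_sdiff_self]; exact subset_union_right)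
      _ ≤ ∫⁻ x in V, f x ∂P + ∫⁻ x in U \ V, f x ∂P := lintegral_union_le _ _ _
      _ ≤ ∫⁻ x in V, f x ∂P + P (U \ V) := by
          gcongr
          calc ∫⁻ x in U \ V, f x ∂P ≤ ∫⁻ _ in U \ V, 1 ∂P := lintegral_mono hf
            _ = P (U \ V) := setLIntegral_one _
  have hle' : ∀ U V E : Set X, P (U ∩ E) ≤ P (V ∩ E) + P (U \ V) := by
    intro U V E
    refine (measure_mono ?_).trans (measure_union_le _ _)
    intro x hx
    by_cases hV : x ∈ V
    · exact Or.inl ⟨hV, hx.2⟩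
    · exact Or.inr ⟨hx.1, hV⟩
  -- `E` may vary with `ε` because `P (A ∩ E)` is always `a`. Passing between `A` and `C` costs `ε /
  -- 2` on each side of the identity.
  refine le_antisymm (ENNReal.le_of_forall_pos_le_add fun ε hε _ => ?_)
    (ENNReal.le_of_forall_pos_le_add fun ε hε _ => ?_)
  all_goals
    have hε2 : (0 : ℝ≥0∞) < (ε : ℝ≥0∞) / 2 := ENNReal.half_pos (by simpa using hε.ne')
    obtain ⟨C, E, hCA, rfl, hCE⟩ := h _ hε2
    have h1 : P (C \ A) ≤ (ε : ℝ≥0∞) / 2 := (measure_mono subset_union_left).trans hCA.le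
    have h2 : P (A \ C) ≤ (ε : ℝ≥0∞) / 2 := (measure_mono subset_union_right).trans hCA.le
  · calc P (A ∩ E) ≤ P (C ∩ E) + P (A \ C) := hle' _ _ _
      _ ≤ (∫⁻ x in A, f x ∂P + P (C \ A)) + P (A \ C) := by rw [hCE]; gcongr; exact hle _ _
      _ ≤ (∫⁻ x in A, f x ∂P + ε / 2) + ε / 2 := by gcongr
      _ = _ := by rw [add_assoc, ENNReal.add_halves]
  · calc ∫⁻ x in A, f x ∂P ≤ ∫⁻ x in C, f x ∂P + P (A \ C) := hle _ _
      _ ≤ (P (A ∩ E) + P (C \ A)) + P (A \ C) := by rw [← hCE]; gcongr; exact hle' _ _ _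
      _ ≤ (P (A ∩ E) + ε / 2) + ε / 2 := by gcongr
      _ = _ := by rw [add_assoc, ENNReal.add_halves]

/-! ### Conditionally i.i.d. families -/

section CondIID

variable {X W L : Type*} {m m' : MeasurableSpace X} [mX : MeasurableSpace X] {Q : Measure X} {V : X → Valuation W L} {O : Set W}
  {Λ : X → LocalLaw L}

theorem prod_indicator_eq_indicator (F : Finset W) (B : W → Set (L → Bool))
    (v : Valuation W L) :
    ∏ w ∈ F, (B w).indicator (fun _ => (1 : ℝ)) (v w)
      = {v : Valuation W L | ∀ w ∈ F, v w ∈ B w}.indicator (fun _ => 1) v := by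
  classical
  simp only [indicator_apply, mem_ofPred_eq]
  split_ifs with h
  · exact Finset.prod_eq_one fun w hw => if_pos (h w hw)
  · push Not at h
    obtain ⟨w, hw, hB⟩ := h
    exact Finset.prod_eq_zero hw (if_neg hB)

variable [Finite L]

theorem measurable_localLaw_apply (B : Set (L → Bool)) :
    Measurable fun l : LocalLaw L => (l : Measure (L → Bool)) B :=
  (Measure.measurable_coe B.toFinite.measurableSet).comp measurable_subtype_coe

theorem measurable_prod_apply (F : Finset W) (B : W → Set (L → Bool)) :
    Measurable fun l : LocalLaw L => ∏ w ∈ F, (l : Measure (L → Bool)) (B w) :=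
  Finset.measurable_prod _ fun w _ => measurable_localLaw_apply (B w)

theorem measurable_prod_real (F : Finset W) (B : W → Set (L → Bool)) :
    Measurable fun l : LocalLaw L => ∏ w ∈ F, (l : Measure (L → Bool)).real (B w) :=
  Finset.measurable_prod _ fun w _ => (measurable_localLaw_apply (B w)).ennreal_toReal

theorem measurableSet_valuation_mem (F : Finset W) (f : W → W) (B : W → Set (L → Bool)) :
    MeasurableSet {V : Valuation W L | ∀ w ∈ F, V (f w) ∈ B w} := by
  have : {V : Valuation W L | ∀ w ∈ F, V (f w) ∈ B w}
      = ⋂ w ∈ F, (fun V : Valuation W L => V (f w)) ⁻¹' B w := by ext; simp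
  rw [this]
  exact F.measurableSet_biInter fun w _ =>
    measurable_pi_apply (f w) (B w).toFinite.measurableSet

variable [IsProbabilityMeasure Q]

/-- The candidate product is `m`-measurable, so it is the conditional expectation as soon as its
integrals over `m`-events are right. The criterion uses `lintegral`, in which mixtures are computed.
-/
theorem condIID_of_measure_inter (hm : m ≤ mX) (hV : Measurable V) (hΛ : Measurable[m] Λ)
    (h : ∀ F : Finset W, (F : Set W) ⊆ O → ∀ B : W → Set (L → Bool), ∀ A, MeasurableSet[m] A →
      Q (A ∩ {x | ∀ w ∈ F, V x w ∈ B w})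
        = ∫⁻ x in A, ∏ w ∈ F, (Λ x : Measure (L → Bool)) (B w) ∂Q) :
    CondIID Q m V O Λ := by
  intro F hF B
  have hE : MeasurableSet {x | ∀ w ∈ F, V x w ∈ B w} :=
    hV (measurableSet_valuation_mem F id B)
  have hf : (fun x => ∏ w ∈ F, (B w).indicator (fun _ => (1 : ℝ)) (V x w))
      = {x | ∀ w ∈ F, V x w ∈ B w}.indicator fun _ => 1 :=
    funext fun x => prod_indicator_eq_indicator F B (V x)
  have hmeas : Measurable[m] fun x => ∏ w ∈ F, (Λ x : Measure (L → Bool)).real (B w) :=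
    (measurable_prod_real F B).comp hΛ
  have hbound : ∀ x, ∏ w ∈ F, (Λ x : Measure (L → Bool)) (B w) ≤ 1 :=
    fun x => Finset.prod_le_one' fun w _ => prob_le_one
  have hreal : ∀ x, ∏ w ∈ F, (Λ x : Measure (L → Bool)).real (B w)
      = (∏ w ∈ F, (Λ x : Measure (L → Bool)) (B w)).toReal :=
    fun x => by rw [ENNReal.toReal_prod]; rfl
  have hint : Integrable (fun x => ∏ w ∈ F, (Λ x : Measure (L → Bool)).real (B w)) Q := by
    refine Integrable.of_bound (hmeas.mono hm le_rfl).aestronglyMeasurable 1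
      (Eventually.of_forall fun x => ?_)
    rw [hreal, Real.norm_of_nonneg ENNReal.toReal_nonneg]
    exact ENNReal.toReal_le_of_le_ofReal zero_le_one (by simpa using hbound x)
  rw [hf]
  refine (ae_eq_condExp_of_forall_setIntegral_eq hm ((integrable_const _).indicator hE)
    (fun s _ _ => hint.integrableOn) (fun A hA _ => ?_)
    hmeas.stronglyMeasurable.aestronglyMeasurable).symm
  rw [setIntegral_indicator hE, setIntegral_const, smul_eq_mul, mul_one, measureReal_def,
    h F hF B A hA]
  simp only [hreal]
  refine integral_toReal ?_ (Eventually.of_forall fun x => (hbound x).trans_lt ENNReal.one_lt_top)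
  exact ((measurable_prod_apply F B).comp (hΛ.mono hm le_rfl)).aemeasurable

/-- The tower property: the product of the `Λ`-probabilities is already measurable for the smaller
field. -/
theorem condIID_of_le (hm : m ≤ mX) (hm' : m' ≤ m)
    (hΛ : Measurable[m'] Λ) (h : CondIID Q m V O Λ) : CondIID Q m' V O Λ := by
  intro F hF B
  have hmeas : Measurable[m'] fun x => ∏ w ∈ F, (Λ x : Measure (L → Bool)).real (B w) :=
    (measurable_prod_real F B).comp hΛ
  have hint : Integrable (fun x => ∏ w ∈ F, (Λ x : Measure (L → Bool)).real (B w)) Q := by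
    exact (integrable_congr (h F hF B)).1 integrable_condExp
  calc _ =ᵐ[Q] Q[Q[fun x => ∏ w ∈ F, (B w).indicator (fun _ => (1 : ℝ)) (V x w) | m] | m'] :=
        (condExp_condExp_of_le hm' hm).symm
    _ =ᵐ[Q] Q[fun x => ∏ w ∈ F, (Λ x : Measure (L → Bool)).real (B w) | m'] :=
        condExp_congr_ae (h F hF B)
    _ = _ := condExp_of_stronglyMeasurable (hm'.trans hm) hmeas.stronglyMeasurable hint

end CondIID

/-! ### Orbits of the stabilizer -/

section Orbits

variable {W L : Type*} {R : W → W → Prop} {w₀ : W}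

theorem orbit_eq_of_mem (O : Orbits R w₀) {w : W} (hw : w ∈ (O : Set W)) :
    (O : Set W) = MulAction.orbit (Stab R w₀) w := by
  obtain ⟨v, hv, hO⟩ := O.2
  have hv' : (O : Set W) = MulAction.orbit (Stab R w₀) v := by
    rw [hO]
    ext u
    exact ⟨fun ⟨π, hπ, h⟩ => ⟨⟨π, hπ⟩, h⟩, fun ⟨π, h⟩ => ⟨π.1, π.2, h⟩⟩
  rw [hv'] at hw ⊢
  exact (MulAction.orbit_eq_iff.2 hw).symm

theorem apply_mem_orbit_iff (O : Orbits R w₀) {π : R ≃r R} (hπ : π ∈ Stab R w₀) {w : W} :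
    π w ∈ (O : Set W) ↔ w ∈ (O : Set W) := by
  constructor
  · intro h
    rw [orbit_eq_of_mem O h]
    exact ⟨⟨π, hπ⟩⁻¹, inv_smul_smul (⟨π, hπ⟩ : Stab R w₀) w⟩
  · intro h
    rw [orbit_eq_of_mem O h]
    exact ⟨⟨π, hπ⟩, rfl⟩

theorem orbit_nonempty (O : Orbits R w₀) : (O : Set W).Nonempty := by
  obtain ⟨v, hv, hO⟩ := O.2
  rw [hO]
  exact ⟨v, 1, one_mem _, rfl⟩

theorem orbit_ext {O O' : Orbits R w₀} {w : W} (hw : w ∈ (O : Set W)) (hw' : w ∈ (O' : Set W)) :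
    O = O' :=
  Subtype.ext ((orbit_eq_of_mem O hw).trans (orbit_eq_of_mem O' hw').symm)

theorem exists_inv_apply_notMem (O : Orbits R w₀) (hO : (O : Set W).Infinite) (F D : Finset W)
    (hF : (F : Set W) ⊆ O) : ∃ π ∈ Stab R w₀, ∀ w ∈ F, π⁻¹ w ∉ D := by
  obtain ⟨g, hg⟩ := exists_smul_notMem_of_infinite_orbit (G := Stab R w₀) F D fun w hw => by
    rw [← orbit_eq_of_mem O (hF hw)]; exact hO
  -- The inverse appears because pulling back by `act π` moves a constraint at `w` to the world `π⁻¹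
  -- w`.
  exact ⟨(g⁻¹ : Stab R w₀), (g⁻¹).2, fun w hw => by
    rw [InvMemClass.coe_inv, inv_inv]; exact hg w hw⟩

end Orbits

/-! ### The mixture of orbit-wise product laws -/

section Mixture

variable {W L : Type*} {R : W → W → Prop} {w₀ : W}

/-- A point mass, serving as default local law. -/
def defaultLaw (L : Type*) : LocalLaw L := ⟨Measure.dirac fun _ => false, inferInstance⟩

open Classical in
/-- The local law at a world, for a family of laws indexed by the orbits. -/
def worldLaw (θ : Orbits R w₀ → LocalLaw L) (w : W) : LocalLaw L :=
  -- The chosen orbit is the only one containing `w`, by `orbit_ext`; the default is used outside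
  -- the cluster.
  if h : ∃ O : Orbits R w₀, w ∈ (O : Set W) then θ h.choose else defaultLaw L

theorem worldLaw_of_mem (θ : Orbits R w₀ → LocalLaw L) (O : Orbits R w₀) {w : W}
    (hw : w ∈ (O : Set W)) : worldLaw θ w = θ O := by
  have h : ∃ O : Orbits R w₀, w ∈ (O : Set W) := ⟨O, hw⟩
  rw [worldLaw, dif_pos h, orbit_ext h.choose_spec hw]

theorem worldLaw_apply (θ : Orbits R w₀ → LocalLaw L) {π : R ≃r R} (hπ : π ∈ Stab R w₀) (w : W) :
    worldLaw θ (π w) = worldLaw θ w := by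
  by_cases h : ∃ O : Orbits R w₀, w ∈ (O : Set W)
  · obtain ⟨O, hw⟩ := h
    rw [worldLaw_of_mem θ O hw, worldLaw_of_mem θ O ((apply_mem_orbit_iff O hπ).2 hw)]
  · have h' : ¬∃ O : Orbits R w₀, π w ∈ (O : Set W) := by
      simpa only [apply_mem_orbit_iff _ hπ] using h
    rw [worldLaw, worldLaw, dif_neg h, dif_neg h']

theorem measurable_worldLaw (w : W) :
    Measurable fun θ : Orbits R w₀ → LocalLaw L => worldLaw θ w := by
  by_cases h : ∃ O : Orbits R w₀, w ∈ (O : Set W)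
  · simp only [worldLaw, dif_pos h]
    exact measurable_pi_apply _
  · simp only [worldLaw, dif_neg h]
    exact measurable_const

/-- The law of a valuation whose values are independent, with local law `θ O` on the orbit `O`. -/
def productLaw (θ : Orbits R w₀ → LocalLaw L) : Measure (Valuation W L) :=
  Measure.infinitePi fun w => (worldLaw θ w : Measure (L → Bool))

instance (θ : Orbits R w₀ → LocalLaw L) : IsProbabilityMeasure (productLaw θ) := by
  unfold productLaw; infer_instance

theorem productLaw_map_comp (θ : Orbits R w₀ → LocalLaw L) {α : Type*} {f : α → W}
    (hf : Function.Injective f) :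
    (productLaw θ).map (fun V a => V (f a))
      = Measure.infinitePi fun a => (worldLaw θ (f a) : Measure (L → Bool)) :=
  Measure.map_infinitePi_infinitePi_of_inj hf

/-- The action permutes the factors of the product, and factors in the same orbit coincide. -/
theorem productLaw_map_act (θ : Orbits R w₀ → LocalLaw L) {π : R ≃r R} (hπ : π ∈ Stab R w₀) :
    (productLaw θ).map (act π) = productLaw θ := by
  refine (productLaw_map_comp θ (f := fun w => π⁻¹ w) (RelIso.injective _)).trans ?_
  simp only [worldLaw_apply θ (inv_mem hπ)]
  rfl

theorem measurable_act (π : R ≃r R) : Measurable (act π : Valuation W L → Valuation W L) :=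
  measurable_pi_lambda _ fun _ => measurable_pi_apply _

variable [Finite L]

theorem productLaw_mem (θ : Orbits R w₀ → LocalLaw L) (F : Finset W) (B : W → Set (L → Bool)) :
    productLaw θ {V | ∀ w ∈ F, V w ∈ B w}
      = ∏ w ∈ F, (worldLaw θ w : Measure (L → Bool)) (B w) :=
  Measure.infinitePi_pi _ fun w _ => (B w).toFinite.measurableSet

theorem productLaw_mem_of_subset (θ : Orbits R w₀ → LocalLaw L) (O : Orbits R w₀) (F : Finset W)
    (hF : (F : Set W) ⊆ O) (B : W → Set (L → Bool)) :
    productLaw θ {V | ∀ w ∈ F, V w ∈ B w} = ∏ w ∈ F, (θ O : Measure (L → Bool)) (B w) := by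
  rw [productLaw_mem]
  exact Finset.prod_congr rfl fun w hw => by rw [worldLaw_of_mem θ O (hF hw)]

theorem productLaw_cylinder_inter (θ : Orbits R w₀ → LocalLaw L) (D F : Finset W)
    (hDF : Disjoint D F) {S : Set ((w : D) → L → Bool)} (hS : MeasurableSet S)
    (B : W → Set (L → Bool)) :
    productLaw θ (cylinder D S ∩ {V | ∀ w ∈ F, V w ∈ B w})
      = productLaw θ (cylinder D S) * productLaw θ {V | ∀ w ∈ F, V w ∈ B w} := by
  have hind := (iIndepFun_infinitePi (P := fun w => (worldLaw θ w : Measure (L → Bool)))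
    (X := fun _ x => x) fun _ => measurable_id).indepFun_finset D F hDF
      fun w => measurable_pi_apply w
  have hset : {V : Valuation W L | ∀ w ∈ F, V w ∈ B w}
      = (fun V (w : F) => V w) ⁻¹' {x | ∀ w : F, x w ∈ B w} := by
    ext V; simp
  have hT : MeasurableSet {x : F → L → Bool | ∀ w : F, x w ∈ B w} := by
    simp only [ofPred_forall]
    exact MeasurableSet.iInter fun w => measurable_pi_apply w (B w).toFinite.measurableSet
  rw [hset]
  exact hind.measure_inter_preimage_eq_mul _ _ hS hT

/-- It suffices to test on the π-system of square cylinders, where the measure is a finite product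
of measurable functions of `θ`. -/
theorem measurable_productLaw :
    Measurable (productLaw : (Orbits R w₀ → LocalLaw L) → Measure (Valuation W L)) := by
  refine Measurable.measure_of_isPiSystem_of_isProbabilityMeasure
    (S := squareCylinders fun _ : W => {s : Set (L → Bool) | MeasurableSet s})
    (generateFrom_squareCylinders (α := fun _ : W => L → Bool)).symm
    (isPiSystem_squareCylinders (fun _ => MeasurableSpace.isPiSystem_measurableSet)
      fun _ => @MeasurableSet.univ (L → Bool) _) ?_
  rintro _ ⟨F, B, _, rfl⟩
  have : ∀ θ : Orbits R w₀ → LocalLaw L, productLaw θ ((F : Set W).pi B)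
      = ∏ w ∈ F, (worldLaw θ w : Measure (L → Bool)) (B w) := fun θ => productLaw_mem θ F B
  simp only [this]
  exact Finset.measurable_prod _ fun w _ =>
    (measurable_localLaw_apply (B w)).comp (measurable_worldLaw w)

/-- `productLaw` as a Markov kernel. -/
def productKernel (R : W → W → Prop) (w₀ : W) (L : Type*) [Finite L] :
    Kernel (Orbits R w₀ → LocalLaw L) (Valuation W L) :=
  ⟨productLaw, measurable_productLaw⟩

instance : IsMarkovKernel (productKernel R w₀ L) :=
  ⟨fun θ => inferInstanceAs (IsProbabilityMeasure (productLaw θ))⟩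

/-- The joint law of a valuation and of latent orbit-wise laws, when the latent laws are chosen
according to `ν` and the valuation is orbit-wise i.i.d. given them. -/
def jointLaw (ν : Measure (Orbits R w₀ → LocalLaw L)) :
    Measure (Valuation W L × (Orbits R w₀ → LocalLaw L)) :=
  (ν ⊗ₘ productKernel R w₀ L).map Prod.swap

variable (ν : Measure (Orbits R w₀ → LocalLaw L))

theorem ae_jointLaw {p : Valuation W L × (Orbits R w₀ → LocalLaw L) → Prop}
    (hp : MeasurableSet {x | p x}) (h : ∀ᵐ θ ∂ν, ∀ᵐ V ∂productLaw θ, p (V, θ)) :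
    ∀ᵐ x ∂jointLaw ν, p x := by
  rw [jointLaw, ae_map_iff measurable_swap.aemeasurable hp]
  exact Measure.ae_compProd_of_ae_ae (measurable_swap hp) h

variable [IsProbabilityMeasure ν]

instance : IsProbabilityMeasure (jointLaw ν) := by
  unfold jointLaw
  exact Measure.isProbabilityMeasure_map measurable_swap.aemeasurable

theorem lintegral_jointLaw {f : Valuation W L × (Orbits R w₀ → LocalLaw L) → ℝ≥0∞}
    (hf : Measurable f) :
    ∫⁻ x, f x ∂jointLaw ν = ∫⁻ θ, ∫⁻ V, f (V, θ) ∂productLaw θ ∂ν := by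
  rw [jointLaw, lintegral_map hf measurable_swap, Measure.lintegral_compProd
    (f := fun x => f x.swap) (hf.comp measurable_swap)]
  rfl

theorem jointLaw_apply {A : Set (Valuation W L × (Orbits R w₀ → LocalLaw L))}
    (hA : MeasurableSet A) :
    jointLaw ν A = ∫⁻ θ, productLaw θ {V | (V, θ) ∈ A} ∂ν := by
  rw [jointLaw, Measure.map_apply measurable_swap hA, Measure.compProd_apply
    (measurable_swap hA)]
  rfl

theorem jointLaw_map_snd : (jointLaw ν).map Prod.snd = ν := by
  rw [jointLaw, Measure.map_map measurable_snd measurable_swap]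
  exact Measure.fst_compProd ν _

theorem jointLaw_map_act {π : R ≃r R} (hπ : π ∈ Stab R w₀) :
    (jointLaw ν).map (fun x => (act π x.1, x.2)) = jointLaw ν := by
  have hm : Measurable fun x : Valuation W L × (Orbits R w₀ → LocalLaw L) => (act π x.1, x.2) :=
    ((measurable_act π).comp measurable_fst).prodMk measurable_snd
  ext A hA
  rw [Measure.map_apply hm hA, jointLaw_apply ν (hm hA), jointLaw_apply ν hA]
  refine lintegral_congr fun θ => ?_
  have hA' : MeasurableSet {V | (V, θ) ∈ A} := measurable_prodMk_right hA
  conv_rhs => rw [← productLaw_map_act θ hπ, Measure.map_apply (measurable_act π) hA']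
  rfl

theorem modallyExchangeable_jointLaw_map_fst :
    ModallyExchangeable R w₀ ((jointLaw ν).map Prod.fst) := by
  intro π hπ A hA
  rw [Measure.map_apply measurable_fst (measurable_act π hA), Measure.map_apply measurable_fst hA]
  conv_rhs => rw [← jointLaw_map_act ν hπ]
  rw [Measure.map_apply _ (measurable_fst hA)]
  · rfl
  · exact ((measurable_act π).comp measurable_fst).prodMk measurable_snd

theorem condIID_jointLaw (O : Orbits R w₀) :
    CondIID (jointLaw ν) (MeasurableSpace.comap Prod.snd inferInstance) Prod.fst (O : Set W)
      fun x => x.2 O := by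
  refine condIID_of_measure_inter measurable_snd.comap_le measurable_fst
    ((measurable_pi_apply O).comp (comap_measurable Prod.snd)) ?_
  rintro F hF B _ ⟨T, hT, rfl⟩
  have hE : MeasurableSet {x : Valuation W L × (Orbits R w₀ → LocalLaw L) |
      ∀ w ∈ F, x.1 w ∈ B w} := measurable_fst (measurableSet_valuation_mem F id B)
  have hg : Measurable fun x : Valuation W L × (Orbits R w₀ → LocalLaw L) =>
      ∏ w ∈ F, (x.2 O : Measure (L → Bool)) (B w) :=
    (measurable_prod_apply F B).comp ((measurable_pi_apply O).comp measurable_snd)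
  rw [jointLaw_apply ν ((measurable_snd hT).inter hE), ← lintegral_indicator (measurable_snd hT),
    lintegral_jointLaw ν (hg.indicator (measurable_snd hT))]
  -- For fixed `θ` the latent event is everything or empty, leaving only the product formula.
  refine lintegral_congr fun θ => ?_
  by_cases hθ : θ ∈ T
  · have h1 : {V : Valuation W L | (V, θ) ∈ Prod.snd ⁻¹' T ∩
        {x : Valuation W L × (Orbits R w₀ → LocalLaw L) | ∀ w ∈ F, x.1 w ∈ B w}}
        = {V | ∀ w ∈ F, V w ∈ B w} := by ext V; simp [hθ]
    rw [h1, productLaw_mem_of_subset θ O F hF B]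
    simp [indicator, hθ]
  · have h1 : {V : Valuation W L | (V, θ) ∈ Prod.snd ⁻¹' T ∩
        {x : Valuation W L × (Orbits R w₀ → LocalLaw L) | ∀ w ∈ F, x.1 w ∈ B w}}
        = ∅ := by ext V; simp [hθ]
    rw [h1]
    simp [indicator, hθ]

theorem isLatentRepresentation_jointLaw : IsLatentRepresentation R w₀ (jointLaw ν) where
  invariant _ hπ := jointLaw_map_act ν hπ
  iid_given_all O := condIID_jointLaw ν O
  iid_given_law O := by
    have hle : MeasurableSpace.comap (fun x : Valuation W L × (Orbits R w₀ → LocalLaw L) => x.2 O)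
        inferInstance ≤ MeasurableSpace.comap Prod.snd inferInstance :=
      ((measurable_pi_apply O).comp (comap_measurable Prod.snd)).comap_le
    exact condIID_of_le measurable_snd.comap_le hle (comap_measurable _) (condIID_jointLaw ν O)

end Mixture

/-! ### Directing laws on the valuation space -/

section Directing

variable {W L : Type*} {R : W → W → Prop} {w₀ : W}

open Classical in
/-- The asymptotic empirical law along an infinite orbit; on a finite orbit, the point mass at the
value in some world of the orbit. -/
def directingLaw (O : Orbits R w₀) (V : Valuation W L) : LocalLaw L :=
  -- The embedding need not exhaust the orbit: any sequence of distinct worlds suffices for the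
  -- strong law.
  if h : (O : Set W).Infinite then limitLaw fun n => V (h.natEmbedding _ n)
  else (⟨Measure.dirac (V (orbit_nonempty O).some), inferInstance⟩ : LocalLaw L)

theorem invariantField_le (P : Measure (Valuation W L)) :
    invariantField R w₀ P ≤ MeasurableSpace.pi := fun _ h => h.1

variable [Finite L]

theorem measurable_directingLaw (O : Orbits R w₀) :
    Measurable (directingLaw O : Valuation W L → LocalLaw L) := by
  by_cases h : (O : Set W).Infinite
  · have h' : (directingLaw O : Valuation W L → LocalLaw L)
        = fun V => limitLaw fun n => V (h.natEmbedding _ n) := funext fun V => dif_pos h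
    rw [h']
    exact measurable_limitLaw.comp (measurable_pi_lambda _ fun n => measurable_pi_apply _)
  · have h' : (directingLaw O : Valuation W L → LocalLaw L) = fun V =>
        (⟨Measure.dirac (V (orbit_nonempty O).some), inferInstance⟩ : LocalLaw L) :=
      funext fun V => dif_neg h
    rw [h']
    exact measurable_comap_iff.2 (Measure.measurable_dirac.comp (measurable_pi_apply _))

theorem measurableSet_localLaw_eq {X : Type*} [MeasurableSpace X] {f g : X → LocalLaw L}
    (hf : Measurable f) (hg : Measurable g) : MeasurableSet {x | f x = g x} := by
  have : {x | f x = g x}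
      = ⋂ s : L → Bool, {x | (f x : Measure (L → Bool)) {s} = (g x : Measure (L → Bool)) {s}} := by
    ext x
    simp only [mem_iInter, mem_ofPred_eq]
    refine ⟨fun h s => by rw [h], fun h => Subtype.ext ?_⟩
    exact Measure.ext_of_singleton h
  rw [this]
  exact MeasurableSet.iInter fun s => measurableSet_eq_fun
    ((measurable_localLaw_apply {s}).comp hf) ((measurable_localLaw_apply {s}).comp hg)

theorem isPointMass_iff {l : LocalLaw L} :
    IsPointMass l ↔ ∃ s : L → Bool, (l : Measure (L → Bool)) {s} = 1 := by
  refine exists_congr fun s => ⟨fun h => by simp [h], fun h => ?_⟩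
  have hae : ∀ᵐ x ∂(l : Measure (L → Bool)), x = s := by
    have := (prob_compl_eq_zero_iff (measurableSet_singleton s)).2 h
    exact this
  have h1 : (l : Measure (L → Bool)).map id = (l : Measure (L → Bool)).map fun _ => s :=
    Measure.map_congr hae
  simpa using h1

theorem measurableSet_isPointMass : MeasurableSet {l : LocalLaw L | IsPointMass l} := by
  simp only [isPointMass_iff, ofPred_exists]
  exact MeasurableSet.iUnion fun s => measurable_localLaw_apply {s} (measurableSet_singleton 1)

theorem ae_productLaw_eq_of_dirac (θ : Orbits R w₀ → LocalLaw L) (O : Orbits R w₀) {s : L → Bool}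
    (hs : (θ O : Measure (L → Bool)) = Measure.dirac s) {w : W} (hw : w ∈ (O : Set W)) :
    ∀ᵐ V ∂productLaw θ, V w = s := by
  have h := productLaw_mem_of_subset θ O {w} (by simpa using hw) fun _ => {s}
  simp only [Finset.mem_singleton, forall_eq, Finset.prod_singleton, hs, mem_singleton_iff,
    Measure.dirac_apply_of_mem (mem_singleton s)] at h
  have hm : MeasurableSet {V : Valuation W L | V w = s} :=
    measurableSet_eq_fun (measurable_pi_apply w) measurable_const
  exact (prob_compl_eq_zero_iff hm).2 h

variable {ν : Measure (Orbits R w₀ → LocalLaw L)}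

/-- The valuation reveals its latent laws. On a finite orbit this rests on `hν`: under a point mass,
one world shows the whole law. -/
theorem ae_directingLaw_eq
    (hν : ∀ O : Orbits R w₀, (O : Set W).Finite → ∀ᵐ θ ∂ν, IsPointMass (θ O)) (O : Orbits R w₀) :
    ∀ᵐ x ∂jointLaw ν, directingLaw O x.1 = x.2 O := by
  refine ae_jointLaw ν (measurableSet_localLaw_eq ((measurable_directingLaw O).comp measurable_fst)
    ((measurable_pi_apply O).comp measurable_snd)) ?_
  by_cases h : (O : Set W).Infinite
  · refine Eventually.of_forall fun θ => ?_
    have hinj : Function.Injective fun n => (h.natEmbedding _ n : W) :=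
      Subtype.val_injective.comp (h.natEmbedding _).injective
    have hmap := productLaw_map_comp θ hinj
    simp only [fun n => worldLaw_of_mem θ O (h.natEmbedding _ n).2] at hmap
    have hlim := ae_limitLaw_eq (θ O)
    rw [← hmap] at hlim
    have := ae_of_ae_map
      (measurable_pi_lambda _ fun n => measurable_pi_apply _ : Measurable _).aemeasurable hlim
    filter_upwards [this] with V hV
    exact (dif_pos h).trans hV
  · filter_upwards [hν O (not_infinite.1 h)] with θ ⟨s, hs⟩
    filter_upwards [ae_productLaw_eq_of_dirac θ O hs (orbit_nonempty O).some_mem] with V hV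
    refine (dif_neg h).trans (Subtype.ext ?_)
    exact (congrArg Measure.dirac hV).trans hs.symm

variable [IsProbabilityMeasure ν]

instance : IsProbabilityMeasure ((jointLaw ν).map Prod.fst) :=
  Measure.isProbabilityMeasure_map measurable_fst.aemeasurable

theorem directingLaw_rigid
    (hν : ∀ O : Orbits R w₀, (O : Set W).Finite → ∀ᵐ θ ∂ν, IsPointMass (θ O)) (O : Orbits R w₀)
    {π : R ≃r R} (hπ : π ∈ Stab R w₀) :
    (fun V => directingLaw O (act π V)) =ᵐ[(jointLaw ν).map Prod.fst] directingLaw O := by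
  refine (ae_map_iff measurable_fst.aemeasurable (measurableSet_localLaw_eq
    ((measurable_directingLaw O).comp (measurable_act π)) (measurable_directingLaw O))).2 ?_
  have h := ae_directingLaw_eq hν O
  have h' := h
  -- Transported by the invariance of `jointLaw`, the identity says that the translated valuation
  -- has the same `θ O` as directing law. No permutation invariance of `limitLaw` is needed.
  rw [← jointLaw_map_act ν hπ] at h'
  filter_upwards [h, ae_of_ae_map
    (((measurable_act π).comp measurable_fst).prodMk measurable_snd).aemeasurable h'] with x hx hx'
  exact hx'.trans hx.symm

theorem measurable_invariantField_directingLaw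
    (hν : ∀ O : Orbits R w₀, (O : Set W).Finite → ∀ᵐ θ ∂ν, IsPointMass (θ O)) (O : Orbits R w₀) :
    Measurable[invariantField R w₀ ((jointLaw ν).map Prod.fst)]
      (directingLaw O : Valuation W L → LocalLaw L) := by
  intro T hT
  refine ⟨measurable_directingLaw O hT, fun π hπ => eventuallyEq_set.2 ?_⟩
  filter_upwards [directingLaw_rigid hν O hπ] with V hV
  simp only [mem_preimage]
  exact iff_of_eq (congrArg (· ∈ T) hV)

/-- Given `θ`, the translated event depends on worlds outside `D`, hence is independent of the
cylinder, and its probability is a product of values of `θ O`. Integrating over `ν` and replacing `θ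
O` by `directingLaw O` gives the formula. -/
theorem measure_cylinder_inter_eq
    (hν : ∀ O : Orbits R w₀, (O : Set W).Finite → ∀ᵐ θ ∂ν, IsPointMass (θ O)) (O : Orbits R w₀)
    {π : R ≃r R} (hπ : π ∈ Stab R w₀) (D F : Finset W) (hF : (F : Set W) ⊆ O)
    (hDF : ∀ w ∈ F, π⁻¹ w ∉ D) {S : Set ((w : D) → L → Bool)} (hS : MeasurableSet S)
    (B : W → Set (L → Bool)) :
    (jointLaw ν).map Prod.fst (cylinder D S ∩ act π ⁻¹' {V | ∀ w ∈ F, V w ∈ B w})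
      = ∫⁻ V in cylinder D S, ∏ w ∈ F, (directingLaw O V : Measure (L → Bool)) (B w)
          ∂(jointLaw ν).map Prod.fst := by
  classical
  have hC : MeasurableSet (cylinder D S : Set (Valuation W L)) := hS.cylinder
  have hE : MeasurableSet (act π ⁻¹' {V : Valuation W L | ∀ w ∈ F, V w ∈ B w}) :=
    measurable_act π (measurableSet_valuation_mem F id B)
  have hE' : (act π ⁻¹' {V : Valuation W L | ∀ w ∈ F, V w ∈ B w})
      = {V | ∀ w ∈ F.image (fun w => π⁻¹ w), V w ∈ B (π w)} := by
    ext V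
    simp [act]
  have hdisj : Disjoint D (F.image fun w => π⁻¹ w) := by
    rw [Finset.disjoint_right]
    simpa using hDF
  have hg : Measurable fun θ : Orbits R w₀ → LocalLaw L =>
      ∏ w ∈ F, (θ O : Measure (L → Bool)) (B w) :=
    (measurable_prod_apply F B).comp (measurable_pi_apply O)
  have hΛ : Measurable fun V : Valuation W L =>
      ∏ w ∈ F, (directingLaw O V : Measure (L → Bool)) (B w) :=
    (measurable_prod_apply F B).comp (measurable_directingLaw O)
  have hprod : ∀ θ : Orbits R w₀ → LocalLaw L,
      productLaw θ (act π ⁻¹' {V : Valuation W L | ∀ w ∈ F, V w ∈ B w})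
        = ∏ w ∈ F, (θ O : Measure (L → Bool)) (B w) := fun θ => by
    have h := Measure.map_apply (μ := productLaw θ) (measurable_act π)
      (measurableSet_valuation_mem (L := L) F id B)
    rw [productLaw_map_act θ hπ] at h
    exact h.symm.trans (productLaw_mem_of_subset θ O F hF B)
  rw [Measure.map_apply measurable_fst (hC.inter hE), jointLaw_apply ν
    (measurable_fst (hC.inter hE)), ← lintegral_indicator hC,
    lintegral_map (hΛ.indicator hC) measurable_fst]
  have hae : (fun x : Valuation W L × (Orbits R w₀ → LocalLaw L) => (cylinder D S).indicator
        (fun V => ∏ w ∈ F, (directingLaw O V : Measure (L → Bool)) (B w)) x.1)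
      =ᵐ[jointLaw ν] (Prod.fst ⁻¹' cylinder D S).indicator
        fun x => ∏ w ∈ F, (x.2 O : Measure (L → Bool)) (B w) := by
    filter_upwards [ae_directingLaw_eq hν O] with x hx
    simp only [indicator, mem_preimage, hx]
  have hmeas : Measurable ((Prod.fst ⁻¹' cylinder D S).indicator
      fun x : Valuation W L × (Orbits R w₀ → LocalLaw L) =>
        ∏ w ∈ F, (x.2 O : Measure (L → Bool)) (B w)) :=
    (hg.comp measurable_snd).indicator (measurable_fst hC)
  rw [lintegral_congr_ae hae, lintegral_jointLaw ν hmeas]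
  refine lintegral_congr fun θ => ?_
  have h1 : ∫⁻ V, (Prod.fst ⁻¹' cylinder D S).indicator
        (fun x : Valuation W L × (Orbits R w₀ → LocalLaw L) =>
          ∏ w ∈ F, (x.2 O : Measure (L → Bool)) (B w)) (V, θ) ∂productLaw θ
      = productLaw θ (cylinder D S) * ∏ w ∈ F, (θ O : Measure (L → Bool)) (B w) := by
    rw [mul_comm, ← lintegral_indicator_const hC]
    rfl
  rw [h1, ← hprod θ, hE']
  exact productLaw_cylinder_inter θ D _ hdisj hS fun w => B (π w)

theorem condIID_invariantField_of_infinite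
    (hν : ∀ O : Orbits R w₀, (O : Set W).Finite → ∀ᵐ θ ∂ν, IsPointMass (θ O)) (O : Orbits R w₀)
    (hO : (O : Set W).Infinite) :
    CondIID ((jointLaw ν).map Prod.fst) (invariantField R w₀ ((jointLaw ν).map Prod.fst)) id
      (O : Set W) (directingLaw O) := by
  refine condIID_of_measure_inter (invariantField_le _) measurable_id
    (measurable_invariantField_directingLaw hν O) ?_
  rintro F hF B A ⟨hA, hinv⟩
  have hE : MeasurableSet {V : Valuation W L | ∀ w ∈ F, V w ∈ B w} :=
    measurableSet_valuation_mem F id B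
  refine measure_eq_setLIntegral_of_approx
    (fun V => Finset.prod_le_one' fun w _ => prob_le_one) fun ε hε => ?_
  obtain ⟨C, hC, hCA⟩ := exists_measure_symmDiff_lt_of_generateFrom_isSetRing
    (μ := (jointLaw ν).map Prod.fst) (isSetRing_measurableCylinders (α := fun _ : W => L → Bool))
    ⟨{univ}, countable_singleton _, singleton_subset_iff.2
      (univ_mem_measurableCylinders fun _ : W => L → Bool), by simp⟩
    (generateFrom_measurableCylinders (α := fun _ : W => L → Bool)).symm hA hε
  obtain ⟨D, S, hS, rfl⟩ := (mem_measurableCylinders C).1 hC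
  obtain ⟨π, hπ, hDF⟩ := exists_inv_apply_notMem O hO F D hF
  refine ⟨_, act π ⁻¹' {V | ∀ w ∈ F, V w ∈ B w}, hCA, ?_,
    measure_cylinder_inter_eq hν O hπ D F hF hDF hS B⟩
  -- Exchangeability moves `A` and the event together; almost invariance then restores `A`.
  refine (modallyExchangeable_jointLaw_map_fst ν π hπ _ (hA.inter hE)).symm.trans ?_
  exact measure_congr ((hinv π hπ).inter (ae_eq_refl _))

/-- All worlds of the orbit almost surely share the value carried by the point mass. The product of
indicators thus equals the product of probabilities before conditioning, and the latter is already
measurable for the invariant field. -/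
theorem condIID_invariantField_of_finite
    (hν : ∀ O : Orbits R w₀, (O : Set W).Finite → ∀ᵐ θ ∂ν, IsPointMass (θ O)) (O : Orbits R w₀)
    (hO : (O : Set W).Finite) :
    CondIID ((jointLaw ν).map Prod.fst) (invariantField R w₀ ((jointLaw ν).map Prod.fst)) id
      (O : Set W) (directingLaw O) := by
  intro F hF B
  have hmeas := (measurable_prod_real F B).comp (measurable_invariantField_directingLaw hν O)
  have hX : Measurable fun V : Valuation W L =>
      ∏ w ∈ F, (B w).indicator (fun _ => (1 : ℝ)) (V w) :=
    Finset.measurable_prod _ fun w _ =>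
      (measurable_const.indicator (B w).toFinite.measurableSet).comp (measurable_pi_apply w)
  have hY : Measurable fun V : Valuation W L =>
      ∏ w ∈ F, (directingLaw O V : Measure (L → Bool)).real (B w) :=
    (measurable_prod_real F B).comp (measurable_directingLaw O)
  have heq : (fun V : Valuation W L => ∏ w ∈ F, (B w).indicator (fun _ => (1 : ℝ)) (V w))
      =ᵐ[(jointLaw ν).map Prod.fst]
        fun V => ∏ w ∈ F, (directingLaw O V : Measure (L → Bool)).real (B w) := by
    refine (ae_map_iff measurable_fst.aemeasurable (measurableSet_eq_fun hX hY)).2 ?_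
    have hlat : ∀ᵐ x ∂jointLaw ν, ∏ w ∈ F, (B w).indicator (fun _ => (1 : ℝ)) (x.1 w)
        = ∏ w ∈ F, (x.2 O : Measure (L → Bool)).real (B w) := by
      refine ae_jointLaw ν (measurableSet_eq_fun (hX.comp measurable_fst)
        ((measurable_prod_real F B).comp ((measurable_pi_apply O).comp measurable_snd))) ?_
      filter_upwards [hν O hO] with θ ⟨s, hs⟩
      have hV : ∀ᵐ V ∂productLaw θ, ∀ w ∈ F, V w = s := (Finset.eventually_all F).2
        fun w hw => ae_productLaw_eq_of_dirac θ O hs (hF hw)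
      filter_upwards [hV] with V hV
      refine Finset.prod_congr rfl fun w hw => ?_
      simp only [hV w hw]
      rw [hs, measureReal_def, Measure.dirac_apply' s (B w).toFinite.measurableSet]
      by_cases hsB : s ∈ B w <;> simp [hsB]
    filter_upwards [hlat, ae_directingLaw_eq hν O] with x hx hx'
    rw [hx, hx']
  have hint : Integrable (fun V : Valuation W L =>
      ∏ w ∈ F, (directingLaw O V : Measure (L → Bool)).real (B w))
        ((jointLaw ν).map Prod.fst) := by
    refine Integrable.of_bound hY.aestronglyMeasurable 1 (Eventually.of_forall fun V => ?_)
    rw [Real.norm_of_nonneg (Finset.prod_nonneg fun w _ => measureReal_nonneg)]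
    exact Finset.prod_le_one (fun w _ => measureReal_nonneg) fun w _ => measureReal_le_one
  exact (condExp_congr_ae heq).trans (Eventually.of_forall fun V => congrFun
    (condExp_of_stronglyMeasurable (invariantField_le _) hmeas.stronglyMeasurable hint) V)

theorem isDirectingFamily_directingLaw
    (hν : ∀ O : Orbits R w₀, (O : Set W).Finite → ∀ᵐ θ ∂ν, IsPointMass (θ O)) :
    IsDirectingFamily R w₀ ((jointLaw ν).map Prod.fst) directingLaw := by
  have hiid : ∀ O : Orbits R w₀, CondIID ((jointLaw ν).map Prod.fst)
      (invariantField R w₀ ((jointLaw ν).map Prod.fst)) id (O : Set W) (directingLaw O) :=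
    fun O => (O : Set W).finite_or_infinite.elim (condIID_invariantField_of_finite hν O)
      (condIID_invariantField_of_infinite hν O)
  exact
    { measurable := measurable_invariantField_directingLaw hν
      rigid := fun O π hπ => directingLaw_rigid hν O hπ
      iid_given_law := fun O => condIID_of_le (invariantField_le _)
        (measurable_invariantField_directingLaw hν O).comap_le (comap_measurable _) (hiid O)
      iid_given_invariant := hiid }

theorem IsDirectingFamily.measureReal_eq_integral {P : Measure (Valuation W L)}
    [IsProbabilityMeasure P] {Λ : Orbits R w₀ → Valuation W L → LocalLaw L}
    (h : IsDirectingFamily R w₀ P Λ) (O : Orbits R w₀) {w : W} (hw : w ∈ (O : Set W))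
    (B : Set (L → Bool)) :
    P.real {V | V w ∈ B} = ∫ V, (Λ O V : Measure (L → Bool)).real B ∂P := by
  have hB : MeasurableSet {V : Valuation W L | V w ∈ B} :=
    measurable_pi_apply w B.toFinite.measurableSet
  have hc := integral_congr_ae (h.iid_given_invariant O {w} (by simpa using hw) fun _ => B)
  rw [integral_condExp (invariantField_le _)] at hc
  simp only [Finset.prod_singleton, id] at hc
  rw [← hc, ← integral_indicator_one hB]
  rfl

end Directing

/-! ### Prescribing the laws on two orbits -/

section Prior

variable {W L : Type*} {R : W → W → Prop} {w₀ : W}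

open Classical in
/-- The family of laws with prescribed values on two orbits, and a default law on the others. -/
def extendLaws (O₁ O₂ : Orbits R w₀) (l : LocalLaw L × LocalLaw L) : Orbits R w₀ → LocalLaw L :=
  fun O => if O = O₁ then l.1 else if O = O₂ then l.2 else defaultLaw L

theorem measurable_extendLaws (O₁ O₂ : Orbits R w₀) :
    Measurable (extendLaws (L := L) O₁ O₂) := by
  refine measurable_pi_lambda _ fun O => ?_
  unfold extendLaws
  split_ifs
  · exact measurable_fst
  · exact measurable_snd
  · exact measurable_const

theorem extendLaws_pair {O₁ O₂ : Orbits R w₀} (hO : O₁ ≠ O₂) (l : LocalLaw L × LocalLaw L) :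
    (extendLaws O₁ O₂ l O₁, extendLaws O₁ O₂ l O₂) = l := by
  simp [extendLaws, hO.symm]

theorem map_extendLaws_pair {O₁ O₂ : Orbits R w₀} (hO : O₁ ≠ O₂)
    (ρ : Measure (LocalLaw L × LocalLaw L)) :
    (ρ.map (extendLaws O₁ O₂)).map (fun θ => (θ O₁, θ O₂)) = ρ := by
  rw [Measure.map_map ((measurable_pi_apply O₁).prodMk (measurable_pi_apply O₂))
    (measurable_extendLaws O₁ O₂)]
  have : (fun θ : Orbits R w₀ → LocalLaw L => (θ O₁, θ O₂)) ∘ extendLaws O₁ O₂ = id :=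
    funext fun l => extendLaws_pair hO l
  rw [this, Measure.map_id]

variable [Finite L]

theorem jointLaw_map_pair {O₁ O₂ : Orbits R w₀} (hO : O₁ ≠ O₂)
    (ρ : Measure (LocalLaw L × LocalLaw L)) [IsProbabilityMeasure ρ] :
    (jointLaw (ρ.map (extendLaws O₁ O₂))).map (fun x => (x.2 O₁, x.2 O₂)) = ρ := by
  have : IsProbabilityMeasure (ρ.map (extendLaws O₁ O₂)) :=
    Measure.isProbabilityMeasure_map (measurable_extendLaws O₁ O₂).aemeasurable
  conv_rhs => rw [← map_extendLaws_pair hO ρ, ← jointLaw_map_snd (ρ.map (extendLaws O₁ O₂))]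
  rw [Measure.map_map ((measurable_pi_apply O₁).prodMk (measurable_pi_apply O₂)) measurable_snd]
  rfl

theorem exists_latentRepresentation {O₁ O₂ : Orbits R w₀} (hO : O₁ ≠ O₂)
    (ρ : Measure (LocalLaw L × LocalLaw L)) [IsProbabilityMeasure ρ] :
    ∃ Q : Measure (Valuation W L × (Orbits R w₀ → LocalLaw L)),
      IsProbabilityMeasure Q ∧ ModallyExchangeable R w₀ (Q.map Prod.fst) ∧
      IsLatentRepresentation R w₀ Q ∧ Q.map (fun x => (x.2 O₁, x.2 O₂)) = ρ := by
  have : IsProbabilityMeasure (ρ.map (extendLaws O₁ O₂)) :=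
    Measure.isProbabilityMeasure_map (measurable_extendLaws O₁ O₂).aemeasurable
  exact ⟨jointLaw (ρ.map (extendLaws O₁ O₂)), inferInstance,
    modallyExchangeable_jointLaw_map_fst _, isLatentRepresentation_jointLaw _,
    jointLaw_map_pair hO ρ⟩

theorem exists_directingFamily {O₁ O₂ : Orbits R w₀} (hO : O₁ ≠ O₂)
    (ρ : Measure (LocalLaw L × LocalLaw L)) [IsProbabilityMeasure ρ]
    (h₁ : (O₁ : Set W).Finite → ∀ᵐ l ∂ρ, IsPointMass l.1)
    (h₂ : (O₂ : Set W).Finite → ∀ᵐ l ∂ρ, IsPointMass l.2) :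
    ∃ (P : Measure (Valuation W L)) (Λ : Orbits R w₀ → Valuation W L → LocalLaw L),
      IsProbabilityMeasure P ∧ ModallyExchangeable R w₀ P ∧ IsDirectingFamily R w₀ P Λ ∧
      P.map (fun V => (Λ O₁ V, Λ O₂ V)) = ρ := by
  have : IsProbabilityMeasure (ρ.map (extendLaws O₁ O₂)) :=
    Measure.isProbabilityMeasure_map (measurable_extendLaws O₁ O₂).aemeasurable
  have hν : ∀ O : Orbits R w₀, (O : Set W).Finite →
      ∀ᵐ θ ∂ρ.map (extendLaws O₁ O₂), IsPointMass (θ O) := by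
    intro O hfin
    refine (ae_map_iff (measurable_extendLaws O₁ O₂).aemeasurable
      (measurable_pi_apply O measurableSet_isPointMass)).2 ?_
    by_cases hO₁ : O = O₁
    · subst hO₁
      simpa [extendLaws] using h₁ hfin
    by_cases hO₂ : O = O₂
    · subst hO₂
      simpa [extendLaws, hO₁] using h₂ hfin
    -- The default law is a point mass precisely so that the remaining finite orbits are admissible.
    · refine Eventually.of_forall fun l => ⟨fun _ => false, ?_⟩
      simp only [extendLaws, hO₁, hO₂, if_false]
      rfl
  refine ⟨_, directingLaw, inferInstance, modallyExchangeable_jointLaw_map_fst _,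
    isDirectingFamily_directingLaw hν, ?_⟩
  rw [Measure.map_map ((measurable_directingLaw O₁).prodMk (measurable_directingLaw O₂))
    measurable_fst]
  refine (Measure.map_congr ?_).trans (jointLaw_map_pair hO ρ)
  filter_upwards [ae_directingLaw_eq hν O₁, ae_directingLaw_eq hν O₂] with x hx₁ hx₂
  simp only [Function.comp_apply, hx₁, hx₂]

theorem exists_directingFamily_ne {O₁ O₂ : Orbits R w₀} (hO : O₁ ≠ O₂) (hL : Nonempty L) :
    ∃ (P : Measure (Valuation W L)) (Λ : Orbits R w₀ → Valuation W L → LocalLaw L),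
      IsProbabilityMeasure P ∧ ModallyExchangeable R w₀ P ∧ IsDirectingFamily R w₀ P Λ ∧
      ∀ᵐ V ∂P, Λ O₁ V ≠ Λ O₂ V := by
  let s₁ : L → Bool := fun _ => false
  let s₂ : L → Bool := fun _ => true
  have hs : s₂ ≠ s₁ := fun h => Bool.noConfusion (congrFun h hL.some)
  let l₁ : LocalLaw L := ⟨Measure.dirac s₁, inferInstance⟩
  let l₂ : LocalLaw L := ⟨Measure.dirac s₂, inferInstance⟩
  have hne : l₁ ≠ l₂ := fun h => by
    have h' : (Measure.dirac s₁ : Measure (L → Bool)) {s₁} = Measure.dirac s₂ {s₁} :=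
      congrArg (fun l : LocalLaw L => (l : Measure (L → Bool)) {s₁}) h
    rw [Measure.dirac_apply' _ (measurableSet_singleton _),
      Measure.dirac_apply' _ (measurableSet_singleton _)] at h'
    simp [hs] at h'
  have hP : MeasurableSet {l : LocalLaw L × LocalLaw L | IsPointMass l.1} :=
    measurable_fst measurableSet_isPointMass
  have hP' : MeasurableSet {l : LocalLaw L × LocalLaw L | IsPointMass l.2} :=
    measurable_snd measurableSet_isPointMass
  have hD : MeasurableSet {l : LocalLaw L × LocalLaw L | l.1 ≠ l.2} :=
    (measurableSet_localLaw_eq measurable_fst measurable_snd).compl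
  -- A deterministic prior at two distinct point masses.
  obtain ⟨P, Λ, h1, h2, h3, h4⟩ := exists_directingFamily hO (Measure.dirac (l₁, l₂))
    (fun _ => (ae_dirac_iff hP).2 ⟨s₁, rfl⟩) (fun _ => (ae_dirac_iff hP').2 ⟨s₂, rfl⟩)
  refine ⟨P, Λ, h1, h2, h3, ?_⟩
  have hmeas : Measurable fun V => (Λ O₁ V, Λ O₂ V) :=
    ((h3.measurable O₁).mono (invariantField_le P) le_rfl).prodMk
      ((h3.measurable O₂).mono (invariantField_le P) le_rfl)
  refine ae_of_ae_map (p := fun l : LocalLaw L × LocalLaw L => l.1 ≠ l.2) hmeas.aemeasurable ?_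
  rw [h4]
  exact (ae_dirac_iff hD).2 hne

/-- A prior carried by point masses, with prescribed expected probability of a local
proposition. -/
theorem exists_pointMass_prior {B : Set (L → Bool)} (hB : B.Nonempty) (hB' : B ≠ univ) {p : ℝ}
    (hp : p ∈ Icc (0 : ℝ) 1) :
    ∃ μ : Measure (LocalLaw L), IsProbabilityMeasure μ ∧ (∀ᵐ l ∂μ, IsPointMass l) ∧
      ∫ l, (l : Measure (L → Bool)).real B ∂μ = p := by
  obtain ⟨s, hs⟩ := hB
  obtain ⟨t, ht⟩ := (ne_univ_iff_exists_notMem B).1 hB'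
  let l : LocalLaw L := ⟨Measure.dirac s, inferInstance⟩
  let l' : LocalLaw L := ⟨Measure.dirac t, inferInstance⟩
  have hl : (l : Measure (L → Bool)).real B = 1 := by
    change (Measure.dirac s).real B = 1
    rw [measureReal_def, Measure.dirac_apply' s B.toFinite.measurableSet]
    simp [hs]
  have hl' : (l' : Measure (L → Bool)).real B = 0 := by
    change (Measure.dirac t).real B = 0
    rw [measureReal_def, Measure.dirac_apply' t B.toFinite.measurableSet]
    simp [ht]
  have hm : Measurable fun l : LocalLaw L => (l : Measure (L → Bool)).real B :=
    (measurable_localLaw_apply B).ennreal_toReal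
  have hint : ∀ l : LocalLaw L, Integrable
      (fun l : LocalLaw L => (l : Measure (L → Bool)).real B) (Measure.dirac l) := fun l =>
    Integrable.of_bound hm.aestronglyMeasurable 1 (Eventually.of_forall fun l => by
      rw [Real.norm_of_nonneg measureReal_nonneg]; exact measureReal_le_one)
  -- With `s ∈ B` and `t ∉ B`, the point mass at `s` is chosen with probability `p` and the one at
  -- `t` otherwise.
  refine ⟨ENNReal.ofReal p • Measure.dirac l + ENNReal.ofReal (1 - p) • Measure.dirac l',
    ⟨?_⟩, ?_, ?_⟩
  · simp [← ENNReal.ofReal_add hp.1 (sub_nonneg.2 hp.2)]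
  · exact ae_add_measure_iff.2
      ⟨Measure.ae_smul_measure ((ae_dirac_iff measurableSet_isPointMass).2 ⟨s, rfl⟩) _,
        Measure.ae_smul_measure ((ae_dirac_iff measurableSet_isPointMass).2 ⟨t, rfl⟩) _⟩
  · rw [integral_add_measure ((hint l).smul_measure ENNReal.ofReal_ne_top)
      ((hint l').smul_measure ENNReal.ofReal_ne_top), integral_smul_measure,
      integral_smul_measure, integral_dirac' _ _ hm.stronglyMeasurable,
      integral_dirac' _ _ hm.stronglyMeasurable, hl, hl', ENNReal.toReal_ofReal hp.1]
    simp

theorem exists_directingFamily_credences {O₁ O₂ : Orbits R w₀} (hO : O₁ ≠ O₂)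
    {B₁ B₂ : Set (L → Bool)} (hB₁ : B₁.Nonempty) (hB₁' : B₁ ≠ univ) (hB₂ : B₂.Nonempty)
    (hB₂' : B₂ ≠ univ) {p₁ p₂ : ℝ} (hp₁ : p₁ ∈ Icc (0 : ℝ) 1) (hp₂ : p₂ ∈ Icc (0 : ℝ) 1) :
    ∃ (P : Measure (Valuation W L)) (Λ : Orbits R w₀ → Valuation W L → LocalLaw L),
      IsProbabilityMeasure P ∧ ModallyExchangeable R w₀ P ∧ IsDirectingFamily R w₀ P Λ ∧
      ∫ V, (Λ O₁ V : Measure (L → Bool)).real B₁ ∂P = p₁ ∧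
      ∫ V, (Λ O₂ V : Measure (L → Bool)).real B₂ ∂P = p₂ ∧
      (∀ w ∈ (O₁ : Set W), P.real {V | V w ∈ B₁} = p₁) ∧
      (∀ w ∈ (O₂ : Set W), P.real {V | V w ∈ B₂} = p₂) := by
  obtain ⟨μ₁, _, hμ₁, hi₁⟩ := exists_pointMass_prior hB₁ hB₁' hp₁
  obtain ⟨μ₂, _, hμ₂, hi₂⟩ := exists_pointMass_prior hB₂ hB₂' hp₂
  -- Only the marginals of the prior matter here; the product is one convenient coupling.
  obtain ⟨P, Λ, h1, h2, h3, h4⟩ := exists_directingFamily hO (μ₁.prod μ₂)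
    (fun _ => Measure.quasiMeasurePreserving_fst.ae hμ₁)
    (fun _ => Measure.quasiMeasurePreserving_snd.ae hμ₂)
  have hΛ : ∀ O, Measurable (Λ O) := fun O => (h3.measurable O).mono (invariantField_le P) le_rfl
  have hr : ∀ B : Set (L → Bool), Measurable fun l : LocalLaw L =>
      (l : Measure (L → Bool)).real B := fun B => (measurable_localLaw_apply B).ennreal_toReal
  have hm : Measurable fun V => (Λ O₁ V, Λ O₂ V) := (hΛ O₁).prodMk (hΛ O₂)
  have e₁ : P.map (Λ O₁) = μ₁ := by
    have := congrArg (Measure.map Prod.fst) h4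
    rw [Measure.map_map measurable_fst hm, Measure.map_fst_prod, measure_univ, one_smul] at this
    exact this
  have e₂ : P.map (Λ O₂) = μ₂ := by
    have := congrArg (Measure.map Prod.snd) h4
    rw [Measure.map_map measurable_snd hm, Measure.map_snd_prod, measure_univ, one_smul] at this
    exact this
  have k₁ : ∫ V, (Λ O₁ V : Measure (L → Bool)).real B₁ ∂P = p₁ := by
    rw [← hi₁, ← e₁]
    exact (integral_map (hΛ O₁).aemeasurable (hr B₁).aestronglyMeasurable).symm
  have k₂ : ∫ V, (Λ O₂ V : Measure (L → Bool)).real B₂ ∂P = p₂ := by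
    rw [← hi₂, ← e₂]
    exact (integral_map (hΛ O₂).aemeasurable (hr B₂).aestronglyMeasurable).symm
  exact ⟨P, Λ, h1, h2, h3, k₁, k₂,
    fun w hw => (h3.measureReal_eq_integral O₁ hw B₁).trans k₁,
    fun w hw => (h3.measureReal_eq_integral O₂ hw B₂).trans k₂⟩

end Prior

end ModalExch

end

theorem mainTheorem4 {W L : Type*} [Countable W] [Finite L] (R : W → W → Prop) (w₀ : W)
    (O₁ O₂ : ModalExch.Orbits R w₀) (hO : O₁ ≠ O₂) :
    -- directing laws on the valuation space with an arbitrary joint prior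
    (∀ ρ : Measure (ModalExch.LocalLaw L × ModalExch.LocalLaw L), IsProbabilityMeasure ρ →
      ((O₁ : Set W).Finite → ∀ᵐ l ∂ρ, ModalExch.IsPointMass l.1) →
      ((O₂ : Set W).Finite → ∀ᵐ l ∂ρ, ModalExch.IsPointMass l.2) →
      ∃ (P : Measure (ModalExch.Valuation W L))
        (Λ : ModalExch.Orbits R w₀ → ModalExch.Valuation W L → ModalExch.LocalLaw L),
        IsProbabilityMeasure P ∧ ModalExch.ModallyExchangeable R w₀ P ∧
        ModalExch.IsDirectingFamily R w₀ P Λ ∧ P.map (fun V => (Λ O₁ V, Λ O₂ V)) = ρ) ∧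
    -- latent directing laws with an arbitrary joint prior, whatever the size of the orbits
    (∀ ρ : Measure (ModalExch.LocalLaw L × ModalExch.LocalLaw L), IsProbabilityMeasure ρ →
      ∃ Q : Measure (ModalExch.Valuation W L × (ModalExch.Orbits R w₀ → ModalExch.LocalLaw L)),
        IsProbabilityMeasure Q ∧ ModalExch.ModallyExchangeable R w₀ (Q.map Prod.fst) ∧
        ModalExch.IsLatentRepresentation R w₀ Q ∧ Q.map (fun x => (x.2 O₁, x.2 O₂)) = ρ) ∧
    -- the directing laws can differ almost surely
    (Nonempty L →
      ∃ (P : Measure (ModalExch.Valuation W L))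
        (Λ : ModalExch.Orbits R w₀ → ModalExch.Valuation W L → ModalExch.LocalLaw L),
        IsProbabilityMeasure P ∧ ModalExch.ModallyExchangeable R w₀ P ∧
        ModalExch.IsDirectingFamily R w₀ P Λ ∧ ∀ᵐ V ∂P, Λ O₁ V ≠ Λ O₂ V) ∧
    -- arbitrary credences about local propositions (possibly the same one) at the two orbits
    (∀ B₁ B₂ : Set (L → Bool), B₁.Nonempty → B₁ ≠ Set.univ → B₂.Nonempty → B₂ ≠ Set.univ →
      ∀ p₁ ∈ Set.Icc (0 : ℝ) 1, ∀ p₂ ∈ Set.Icc (0 : ℝ) 1,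
      ∃ (P : Measure (ModalExch.Valuation W L))
        (Λ : ModalExch.Orbits R w₀ → ModalExch.Valuation W L → ModalExch.LocalLaw L),
        IsProbabilityMeasure P ∧ ModalExch.ModallyExchangeable R w₀ P ∧
        ModalExch.IsDirectingFamily R w₀ P Λ ∧
        ∫ V, (Λ O₁ V : Measure (L → Bool)).real B₁ ∂P = p₁ ∧
        ∫ V, (Λ O₂ V : Measure (L → Bool)).real B₂ ∂P = p₂ ∧
        (∀ w ∈ (O₁ : Set W), P.real {V | V w ∈ B₁} = p₁) ∧
        (∀ w ∈ (O₂ : Set W), P.real {V | V w ∈ B₂} = p₂)) :=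
  ⟨fun ρ _ h₁ h₂ => ModalExch.exists_directingFamily hO ρ h₁ h₂,
    fun ρ _ => ModalExch.exists_latentRepresentation hO ρ,
    fun hL => ModalExch.exists_directingFamily_ne hO hL,
    fun _ _ hB₁ hB₁' hB₂ hB₂' _ hp₁ _ hp₂ =>
      ModalExch.exists_directingFamily_credences hO hB₁ hB₁' hB₂ hB₂' hp₁ hp₂⟩
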